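/- Let $R$ and $S$ be associative rings with unit and let ${}_R\omega_S$ be a semidualizing $(R,S)$-bimodule; that is: ${}_R\omega$ and $\omega_S$ each admit a projective resolution all of whose terms are finitely generated; the homothety maps $R\to\mathrm{Hom}_{S^{op}}(\omega,\omega)$, $r\mapsto(x\mapsto rx)$, and $S\to\mathrm{Hom}_R(\omega,\omega)$, $s\mapsto(x\mapsto xs)$, are isomorphisms; and $\mathrm{Ext}_R^i(\omega,\omega)=0=\mathrm{Ext}_{S^{op}}^i(\omega,\omega)$ for all $i\ge 1$. For a left $R$-module $M$ and a left $S$-module $N$, define the Ext-cograde of $M$ and the Tor-cograde of $N$ with respect to $\omega$ by $$\mathrm{E\text{-}cograde}_\omega M:=\inf\{i\ge 0\mid \mathrm{Ext}_R^i(\omega,M)\ne 0\},\qquad \mathrm{T\text{-}cograde}_\omega N:=\inf\{i\ge 0\mid \mathrm{Tor}^S_i(\omega,N)\ne 0\},$$ where $\inf\emptyset=\infty$. Here $\mathrm{Ext}_R^i(\omega,M)$ is a left $S$-module through the right action of $S$ on $\omega$, and $\mathrm{Tor}^S_i(\omega,N)$ is a left $R$-module through the left action of $R$ on $\omega$. Then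 for every left $R$-module $M$, every left $S$-module $N$ and every integer $n\ge 0$: (1) If $\mathrm{T\text{-}cograde}_\omega\,\mathrm{Ext}_R^i(\omega,M)\ge i+1$ for all $0\le i\le n$, then $\mathrm{E\text{-}cograde}_\omega M\ge n+1$. (2) If $\mathrm{E\text{-}cograde}_\omega\,\mathrm{Tor}^S_i(\omega,N)\ge i+1$ for all $0\le i\le n$, then $\mathrm{T\text{-}cograde}_\omega N\ge n+1$. -/

import Mathlib

open CategoryTheory
open scoped TensorProduct

universe u

noncomputable section

/-! Left modules over `R` are objects of `ModuleCat R`; right `S`-modules are left modules over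
the opposite ring `Sᵐᵒᵖ`, with `MulOpposite.op s • x` standing for `x s`. An `(R, S)`-bimodule `ω`
carries `Module R ω`, `Module Sᵐᵒᵖ ω` and `SMulCommClass R Sᵐᵒᵖ ω`, that is, `r (x s) = (r x) s`. -/

namespace Semidualizing

section Tensor

variable (R S ω : Type u) [Ring R] [Ring S] [AddCommGroup ω] [Module R ω] [Module Sᵐᵒᵖ ω]

/-- The `R`-submodule of `ω ⊗_ℤ N` generated by the elements `x s ⊗ y - x ⊗ s y`. When `ω` is a
bimodule, it coincides with the additive subgroup that these elements generate. -/
def balancing (N : Type u) [AddCommGroup N] [Module S N] : Submodule R (ω ⊗[ℤ] N) :=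
  Submodule.span R
    {t | ∃ (x : ω) (s : S) (y : N), t = (MulOpposite.op s • x) ⊗ₜ[ℤ] y - x ⊗ₜ[ℤ] (s • y)}

/-- The tensor product `ω ⊗_S N` of an `(R, S)`-bimodule and a left `S`-module, as a left
`R`-module. -/
abbrev BalancedTensor (N : Type u) [AddCommGroup N] [Module S N] : Type u :=
  (ω ⊗[ℤ] N) ⧸ balancing R S ω N

/-- The `R`-linear map `1 ⊗ f : ω ⊗_S N → ω ⊗_S N'`. -/
def balancedMap {N N' : Type u} [AddCommGroup N] [Module S N] [AddCommGroup N'] [Module S N']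
    (f : N →ₗ[S] N') : BalancedTensor R S ω N →ₗ[R] BalancedTensor R S ω N' :=
  (balancing R S ω N).mapQ (balancing R S ω N')
    (TensorProduct.AlgebraTensorModule.map LinearMap.id f.toAddMonoidHom.toIntLinearMap) <| by
      refine Submodule.span_le.2 ?_
      rintro _ ⟨x, s, y, rfl⟩
      refine Submodule.subset_span ⟨x, s, f y, ?_⟩
      simp

/-- The class of `x ⊗ y` in `ω ⊗_S N`. -/
def btmul {N : Type u} [AddCommGroup N] [Module S N] (x : ω) (y : N) : BalancedTensor R S ω N :=
  (balancing R S ω N).mkQ (x ⊗ₜ[ℤ] y)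

variable {R S ω} in
theorem balancedTensor_hom_ext {N P : Type u} [AddCommGroup N] [Module S N] [AddCommGroup P]
    [Module R P] {f g : BalancedTensor R S ω N →ₗ[R] P}
    (h : ∀ x y, f (btmul R S ω x y) = g (btmul R S ω x y)) : f = g := by
  apply Submodule.linearMap_qext
  apply TensorProduct.AlgebraTensorModule.ext
  exact h

theorem balancedMap_btmul {N N' : Type u} [AddCommGroup N] [Module S N] [AddCommGroup N']
    [Module S N'] (f : N →ₗ[S] N') (x : ω) (y : N) :
    balancedMap R S ω f (btmul R S ω x y) = btmul R S ω x (f y) := rfl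

/-- The functor `ω ⊗_S - : Mod S ⥤ Mod R`. -/
def tensorFunctor : ModuleCat.{u} S ⥤ ModuleCat.{u} R where
  obj N := ModuleCat.of R (BalancedTensor R S ω N)
  map f := ModuleCat.ofHom (balancedMap R S ω f.hom)
  map_id N := by
    ext : 1
    exact balancedTensor_hom_ext fun x y => rfl
  map_comp f g := by
    ext : 1
    exact balancedTensor_hom_ext fun x y => rfl

instance : (tensorFunctor R S ω).Additive where
  map_add {N N'} f g := by
    ext : 1
    refine balancedTensor_hom_ext fun x y => ?_
    change btmul R S ω x (f.hom y + g.hom y) = btmul R S ω x (f.hom y) + btmul R S ω x (g.hom y)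
    simp only [btmul, TensorProduct.tmul_add, map_add]

/-- The left `R`-module `Tor_i^S(ω, N)`: the `i`-th left derived functor of `ω ⊗_S -` at `N`. -/
def torModule (i : ℕ) (N : ModuleCat.{u} S) : ModuleCat.{u} R :=
  ((tensorFunctor R S ω).leftDerived i).obj N

end Tensor

section Ext

variable (R S ω : Type u) [Ring R] [Ring S] [AddCommGroup ω] [Module R ω] [Module Sᵐᵒᵖ ω]
  [SMulCommClass R Sᵐᵒᵖ ω]

/-- Right multiplication by `s` on `ω`, an endomorphism of the left `R`-module `ω`. -/
def rightMul (s : S) : ModuleCat.of R ω ⟶ ModuleCat.of R ω :=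
  ModuleCat.ofHom
    { toFun := fun x => MulOpposite.op s • x
      map_add' := fun x y => smul_add _ x y
      map_smul' := fun r x => (smul_comm r (MulOpposite.op s) x).symm }

/-- The abelian group `Ext^i_R(ω, M)`. The ring `S` is recorded because it acts on the left. -/
@[nolint unusedArguments]
def ExtGroup (_S : Type u) (i : ℕ) (M : ModuleCat.{u} R) : Type u :=
  Abelian.Ext.{u} (ModuleCat.of R ω) M i

instance (i : ℕ) (M : ModuleCat.{u} R) : AddCommGroup (ExtGroup R ω S i M) :=
  inferInstanceAs (AddCommGroup (Abelian.Ext.{u} (ModuleCat.of R ω) M i))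

/-- `S` acts on `Ext^i_R(ω, M)` through its right action on `ω`; in degree zero this is
`(s f)(x) = f(x s)`. -/
instance (i : ℕ) (M : ModuleCat.{u} R) : Module S (ExtGroup R ω S i M) where
  smul s e := (Abelian.Ext.mk₀ (rightMul R S ω s)).comp (Z := M) e (zero_add i)
  one_smul e := by
    have h : rightMul R S ω 1 = 𝟙 _ := by ext x; exact one_smul Sᵐᵒᵖ x
    change (Abelian.Ext.mk₀ (rightMul R S ω 1)).comp (Z := M) e (zero_add i) = e
    rw [h]
    exact Abelian.Ext.mk₀_id_comp (Y := M) e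
  mul_smul s t e := by
    have h : rightMul R S ω (s * t) = rightMul R S ω s ≫ rightMul R S ω t := by
      ext x; exact mul_smul (MulOpposite.op t) (MulOpposite.op s) x
    change (Abelian.Ext.mk₀ (rightMul R S ω (s * t))).comp (Z := M) e (zero_add i) =
      (Abelian.Ext.mk₀ (rightMul R S ω s)).comp (Z := M)
        ((Abelian.Ext.mk₀ (rightMul R S ω t)).comp (Z := M) e (zero_add i)) (zero_add i)
    rw [h]
    exact (Abelian.Ext.mk₀_comp_mk₀_assoc (T := M) _ _ e).symm
  smul_zero s := Abelian.Ext.comp_zero (Abelian.Ext.mk₀ (rightMul R S ω s)) M i i (zero_add i)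
  smul_add s e e' :=
    Abelian.Ext.comp_add (Z := M) (Abelian.Ext.mk₀ (rightMul R S ω s)) e e' (zero_add i)
  add_smul s t e := by
    have h : rightMul R S ω (s + t) = rightMul R S ω s + rightMul R S ω t := by
      ext x; exact add_smul (MulOpposite.op s) (MulOpposite.op t) x
    change (Abelian.Ext.mk₀ (rightMul R S ω (s + t))).comp (Z := M) e (zero_add i) =
      (Abelian.Ext.mk₀ (rightMul R S ω s)).comp (Z := M) e (zero_add i) +
        (Abelian.Ext.mk₀ (rightMul R S ω t)).comp (Z := M) e (zero_add i)
    rw [h, Abelian.Ext.mk₀_add]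
    exact Abelian.Ext.add_comp (Z := M) _ _ e (zero_add i)
  zero_smul e := by
    have h : rightMul R S ω 0 = 0 := by ext x; exact zero_smul Sᵐᵒᵖ x
    change (Abelian.Ext.mk₀ (rightMul R S ω 0)).comp (Z := M) e (zero_add i) = 0
    rw [h, Abelian.Ext.mk₀_zero]
    exact Abelian.Ext.zero_comp (ModuleCat.of R ω) 0 (β := (show Abelian.Ext.{u} _ M i from e)) i (zero_add i)

/-- The left `S`-module `Ext^i_R(ω, M)`. -/
def extModule (i : ℕ) (M : ModuleCat.{u} R) : ModuleCat.{u} S :=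
  ModuleCat.of S (ExtGroup R ω S i M)

/-- The `(R, S)`-bimodule `ω` is semidualizing. -/
structure IsSemidualizing : Prop where
  /-- `ω` has a degreewise finite projective resolution over `R`. -/
  finite_left : ∃ P : ProjectiveResolution (ModuleCat.of R ω),
    ∀ i, Module.Finite R (P.complex.X i)
  /-- `ω` has a degreewise finite projective resolution as a right `S`-module. -/
  finite_right : ∃ P : ProjectiveResolution (ModuleCat.of Sᵐᵒᵖ ω),
    ∀ i, Module.Finite Sᵐᵒᵖ (P.complex.X i)
  /-- The homothety map `R → Hom_{Sᵒᵖ}(ω, ω)`, `r ↦ (x ↦ r x)`, is an isomorphism. -/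
  homothety_left : Function.Bijective (Module.toModuleEnd Sᵐᵒᵖ ω : R →+* Module.End Sᵐᵒᵖ ω)
  /-- The homothety map `S → Hom_R(ω, ω)`, `s ↦ (x ↦ x s)`, is an isomorphism. -/
  homothety_right : Function.Bijective (rightMul R S ω)
  /-- `Ext^i_R(ω, ω) = 0` for `i ≥ 1`. -/
  ext_left : ∀ i : ℕ, 1 ≤ i →
    Subsingleton (Abelian.Ext.{u} (ModuleCat.of R ω) (ModuleCat.of R ω) i)
  /-- `Ext^i_{Sᵒᵖ}(ω, ω) = 0` for `i ≥ 1`. -/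
  ext_right : ∀ i : ℕ, 1 ≤ i →
    Subsingleton (Abelian.Ext.{u} (ModuleCat.of Sᵐᵒᵖ ω) (ModuleCat.of Sᵐᵒᵖ ω) i)

end Ext

/-- The Ext-cograde `inf {i ≥ 0 | Ext^i_R(ω, M) ≠ 0}` of the left `R`-module `M`; the infimum of
the empty set is `∞`. -/
def extCograde (R ω : Type u) [Ring R] [AddCommGroup ω] [Module R ω] (M : ModuleCat.{u} R) : ℕ∞ :=
  sInf ((fun i : ℕ => (i : ℕ∞)) '' {i | Nontrivial (Abelian.Ext.{u} (ModuleCat.of R ω) M i)})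

/-- The Tor-cograde `inf {i ≥ 0 | Tor_i^S(ω, N) ≠ 0}` of the left `S`-module `N`; the infimum of
the empty set is `∞`. -/
def torCograde (R S ω : Type u) [Ring R] [Ring S] [AddCommGroup ω] [Module R ω] [Module Sᵐᵒᵖ ω]
    (N : ModuleCat.{u} S) : ℕ∞ :=
  sInf ((fun i : ℕ => (i : ℕ∞)) '' {i | Nontrivial (torModule R S ω i N)})

end Semidualizing

end

/-! By strong induction on `i`, it suffices to kill Ext^i (or Tor_i) once all lower degrees vanish.

For (1), put E = Ext^i(ω, M) and let I be an injective resolution of M, so L = Hom_R(ω, I) has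
cohomology Ext(ω, M) and is exact below degree i. As ω ⊗_S - is left adjoint to Hom_R(ω, -),
vanishing of Tor_j(ω, E) forces Ext_S^j(E, L^k) = 0 for each k, hence for all j ≤ i
(`subsingleton_ext_of_injective`). Dimension shifting along L then gives Hom_S(E, H^i(L)) = 0
(`CochainComplex.hom_homology_eq_zero`). But H^i(L) ≅ E, so the identity of E is zero.

Part (2) is dual: use ω ⊗_S P for a projective resolution P of N, and Hom out of its homology. -/

noncomputable section

/-! ### Dimension shifting along complexes. -/

section Homological

open Abelian Limits

universe w v v' u' u''

variable {C : Type u'} [Category.{v} C] [Abelian C]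

/-- A cochain complex with vanishing cohomology below degree `i`, whose terms receive no
extensions of degree at most `i` from `X`, has no nonzero morphism from `X` to its cohomology in
degree `i`. -/
theorem CochainComplex.hom_homology_eq_zero [HasExt.{w} C] (L : CochainComplex C ℕ) (X : C) (i : ℕ)
    (hL : ∀ k < i, L.ExactAt k)
    (hX : ∀ k j, j ≤ i → Subsingleton (Ext.{w} X (L.X k) j)) (f : X ⟶ L.homology i) : f = 0 := by
  -- Dimension shifting: Ext^j(X, opcycles (k+1)) lies between Ext^j(X, L^(k+1)) and Ext^(j+1)(X,
  -- opcycles k). The bound on `j + k` is preserved and leaves Hom at `k = i`.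
  have key : ∀ k, k ≤ i → ∀ j, j + k ≤ i → Subsingleton (Ext.{w} X (L.opcycles k) j) := by
    intro k
    induction k with
    | zero =>
      intro _ j hj
      have := hX 0 j hj
      have e : L.X 0 ≅ L.opcycles 0 := asIso (L.pOpcycles 0)
      refine ⟨fun a b => ?_⟩
      have h : ∀ c : Ext.{w} X (L.opcycles 0) j, c = 0 := fun c => by
        rw [← Ext.comp_mk₀_id c, ← e.inv_hom_id, ← Ext.mk₀_comp_mk₀,
          ← Ext.comp_assoc_of_third_deg_zero,
          Subsingleton.elim (c.comp (Ext.mk₀ e.inv) (add_zero j)) 0, Ext.zero_comp]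
      rw [h a, h b]
    | succ k ih =>
      intro hk j hj
      have hex := hL k (by omega)
      -- The kernel of `fromOpcycles` is the homology in degree `k`, so exactness there is what
      -- makes the left map mono.
      let T : ShortComplex C := ShortComplex.mk (L.fromOpcycles k (k + 1)) (L.pOpcycles (k + 1))
        (by rw [← cancel_epi (L.pOpcycles k)]; simp)
      have hT : T.ShortExact :=
        { exact := by
            apply ShortComplex.exact_of_g_is_cokernel
            exact CokernelCofork.IsColimit.ofπ _ _
              (fun a ha => L.descOpcycles a k (by simp) (by
                rw [← L.p_fromOpcycles k (k + 1), Category.assoc]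
                exact (congrArg _ ha).trans comp_zero))
              (fun a ha => L.p_descOpcycles _ _ _ _)
              (fun a ha b hb => by rw [← cancel_epi (L.pOpcycles (k + 1))]; simpa using hb)
          mono_f := Preadditive.mono_of_isZero_kernel' _ (L.homologyIsKernel k (k + 1) (by simp))
            ((L.exactAt_iff_isZero_homology k).1 hex)
          epi_g := inferInstanceAs (Epi (L.pOpcycles (k + 1))) }
      have h' := ih (by omega) (j + 1) (by omega)
      have h : ∀ c : Ext.{w} X (L.opcycles (k + 1)) j, c = 0 := fun c => by
        obtain ⟨x, rfl⟩ := Ext.covariant_sequence_exact₃ X hT c rfl (Subsingleton.elim _ _)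
        have hx : x = 0 := (hX (k + 1) j (by omega)).elim _ _
        rw [hx, Ext.zero_comp]
      exact ⟨fun a b => by rw [h a, h b]⟩
  have := key i le_rfl 0 (by omega)
  -- Homology embeds in the opcycles, where Hom from `X` already vanishes.
  rw [← cancel_mono (L.homologyι i), zero_comp]
  exact Ext.addEquiv₀.symm.injective (Subsingleton.elim _ _)

/-- A chain complex with vanishing homology below degree `i`, whose terms have no extensions of
degree at most `i` by `Y`, has no nonzero morphism from its homology in degree `i` to `Y`. -/
theorem ChainComplex.hom_homology_eq_zero [HasExt.{w} C] (K : ChainComplex C ℕ) (Y : C) (i : ℕ)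
    (hK : ∀ k < i, K.ExactAt k)
    (hY : ∀ k j, j ≤ i → Subsingleton (Ext.{w} (K.X k) Y j)) (f : K.homology i ⟶ Y) : f = 0 := by
  -- Dual shifting, along cycles (k+1) → K_(k+1) → cycles k; exactness in degree `k` makes the
  -- second map epi.
  have key : ∀ k, k ≤ i → ∀ j, j + k ≤ i → Subsingleton (Ext.{w} (K.cycles k) Y j) := by
    intro k
    induction k with
    | zero =>
      intro _ j hj
      have := hY 0 j hj
      have e : K.cycles 0 ≅ K.X 0 := asIso (K.iCycles 0)
      refine ⟨fun a b => ?_⟩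
      have h : ∀ c : Ext.{w} (K.cycles 0) Y j, c = 0 := fun c => by
        rw [← Ext.mk₀_id_comp c, ← e.hom_inv_id, ← Ext.mk₀_comp_mk₀_assoc,
          Subsingleton.elim ((Ext.mk₀ e.inv).comp c (zero_add j)) 0, Ext.comp_zero]
      rw [h a, h b]
    | succ k ih =>
      intro hk j hj
      have hex := hK k (by omega)
      let T : ShortComplex C := ShortComplex.mk (K.iCycles (k + 1)) (K.toCycles (k + 1) k)
        (by rw [← cancel_mono (K.iCycles k)]; simp)
      have hT : T.ShortExact :=
        { exact := by
            apply ShortComplex.exact_of_f_is_kernel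
            exact KernelFork.IsLimit.ofι _ _
              (fun a ha => K.liftCycles a k (by simp) (by
                rw [← K.toCycles_i (k + 1) k, ← Category.assoc]
                exact (congrArg (· ≫ K.iCycles k) ha).trans zero_comp))
              (fun a ha => K.liftCycles_i _ _ _ _)
              (fun a ha b hb => by rw [← cancel_mono (K.iCycles (k + 1))]; simpa using hb)
          mono_f := inferInstanceAs (Mono (K.iCycles (k + 1)))
          epi_g := Preadditive.epi_of_isZero_cokernel' _
            (K.homologyIsCokernel (k + 1) k (by simp))
            ((K.exactAt_iff_isZero_homology k).1 hex) }
      have h' := ih (by omega) (j + 1) (by omega)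
      have h : ∀ c : Ext.{w} (K.cycles (k + 1)) Y j, c = 0 := fun c => by
        have h'' : Subsingleton (Ext.{w} T.X₃ Y (j + 1)) := h'
        obtain ⟨x, rfl⟩ := Ext.contravariant_sequence_exact₁ hT Y c (add_comm 1 j)
          (Subsingleton.elim _ _)
        have hx : x = 0 := (hY (k + 1) j (by omega)).elim _ _
        rw [hx, Ext.comp_zero]
      exact ⟨fun a b => by rw [h a, h b]⟩
  have := key i le_rfl 0 (by omega)
  rw [← cancel_epi (K.homologyπ i), comp_zero]
  exact Ext.addEquiv₀.symm.injective (Subsingleton.elim _ _)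

/-! ### Adjunctions and vanishing of Ext. -/

variable {D : Type u''} [Category.{v'} D] [Abelian D] {F : C ⥤ D} {G : D ⥤ C}

theorem CategoryTheory.Adjunction.homEquiv_zero [G.Additive] (adj : F ⊣ G) (X : C) (Y : D) :
    adj.homEquiv X Y 0 = 0 := by
  simp [Adjunction.homEquiv_unit]

theorem CategoryTheory.Adjunction.homEquiv_symm_zero [F.Additive] (adj : F ⊣ G) (X : C) (Y : D) :
    (adj.homEquiv X Y).symm 0 = 0 := by
  simp [Adjunction.homEquiv_counit]

/-- If `F ⊣ G` and the `j`-th left derived functor of `F` vanishes at `X`, there are no extensions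
of degree `j` of `X` by `G I` for `I` injective. -/
theorem CategoryTheory.Adjunction.subsingleton_ext_of_injective [HasExt.{w} C] [F.Additive] (adj : F ⊣ G)
    {X : C} (P : ProjectiveResolution X) (I : D) [Injective I] (j : ℕ)
    (h : ((F.mapHomologicalComplex _).obj P.complex).ExactAt j) :
    Subsingleton (Ext.{w} X (G.obj I) j) := by
  -- Represent `c` by a cocycle P_j → G I. Its transpose F P_j → I kills the incoming boundary, so
  -- by exactness and injectivity of `I` it factors through the outgoing differential; transposing
  -- back exhibits a coboundary.
  have H : ∀ c : Ext.{w} X (G.obj I) j, c = 0 := fun c => by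
    obtain ⟨f, hf, rfl⟩ := P.extMk_surjective c (j + 1) rfl
    have hf' : F.map (P.complex.d (j + 1) j) ≫ (adj.homEquiv _ _).symm f = 0 := by
      rw [← adj.homEquiv_naturality_left_symm, hf, adj.homEquiv_symm_zero]
    cases j with
    | zero =>
      -- The index after 0 is 0 itself and `d 0 0 = 0`, so the factorization forces `f = 0`.
      rw [HomologicalComplex.exactAt_iff' _ 1 0 0 (by simp) (by simp)] at h
      obtain ⟨g, e⟩ : ∃ g : F.obj (P.complex.X 0) ⟶ I, F.map (P.complex.d 0 0) ≫ g =
          (adj.homEquiv _ _).symm f := ⟨_, h.comp_descToInjective ((adj.homEquiv _ _).symm f) hf'⟩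
      have hf0 : f = 0 := by
        apply (adj.homEquiv _ _).symm.injective
        rw [adj.homEquiv_symm_zero, ← e]
        simp
      subst hf0
      exact P.extMk_zero _ _
    | succ j =>
      rw [HomologicalComplex.exactAt_iff' _ (j + 2) (j + 1) j (by simp) (by simp)] at h
      obtain ⟨g, e⟩ : ∃ g : F.obj (P.complex.X j) ⟶ I, F.map (P.complex.d (j + 1) j) ≫ g =
          (adj.homEquiv _ _).symm f := ⟨_, h.comp_descToInjective ((adj.homEquiv _ _).symm f) hf'⟩
      rw [P.extMk_eq_zero_iff _ _ _ _ j rfl]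
      refine ⟨adj.homEquiv _ _ g, ?_⟩
      rw [← adj.homEquiv_naturality_left, ← Equiv.eq_symm_apply]
      exact e
  exact ⟨fun a b => by rw [H a, H b]⟩

/-- If `F ⊣ G` and the `j`-th right derived functor of `G` vanishes at `Y`, there are no extensions
of degree `j` of `F P` by `Y` for `P` projective. -/
theorem CategoryTheory.Adjunction.subsingleton_ext_of_projective [HasExt.{w} D] [G.Additive] (adj : F ⊣ G)
    {Y : D} (I : InjectiveResolution Y) (P : C) [Projective P] (j : ℕ)
    (h : ((G.mapHomologicalComplex _).obj I.cocomplex).ExactAt j) :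
    Subsingleton (Ext.{w} (F.obj P) Y j) := by
  have H : ∀ c : Ext.{w} (F.obj P) Y j, c = 0 := fun c => by
    obtain ⟨f, hf, rfl⟩ := I.extMk_surjective c (j + 1) rfl
    have hf' : adj.homEquiv _ _ f ≫ G.map (I.cocomplex.d j (j + 1)) = 0 := by
      rw [← adj.homEquiv_naturality_right, hf, adj.homEquiv_zero]
    cases j with
    | zero =>
      rw [HomologicalComplex.exactAt_iff' _ 0 0 1 (by simp) (by simp)] at h
      obtain ⟨g, e⟩ : ∃ g : P ⟶ G.obj (I.cocomplex.X 0), g ≫ G.map (I.cocomplex.d 0 0) =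
          adj.homEquiv _ _ f := ⟨_, h.liftFromProjective_comp (adj.homEquiv _ _ f) hf'⟩
      have hf0 : f = 0 := by
        apply (adj.homEquiv _ _).injective
        rw [adj.homEquiv_zero, ← e]
        simp
      subst hf0
      exact I.extMk_zero _ _
    | succ j =>
      rw [HomologicalComplex.exactAt_iff' _ j (j + 1) (j + 2) (by simp) (by simp)] at h
      obtain ⟨g, e⟩ : ∃ g : P ⟶ G.obj (I.cocomplex.X j), g ≫ G.map (I.cocomplex.d j (j + 1)) =
          adj.homEquiv _ _ f := ⟨_, h.liftFromProjective_comp (adj.homEquiv _ _ f) hf'⟩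
      rw [I.extMk_eq_zero_iff _ _ _ _ j rfl]
      refine ⟨(adj.homEquiv _ _).symm g, ?_⟩
      rw [← adj.homEquiv_naturality_right_symm, Equiv.symm_apply_eq]
      exact e
  exact ⟨fun a b => by rw [H a, H b]⟩

open CochainComplex HomComplex in
-- A coboundary in degree 0 factors through degree -1, where the resolution is zero. This covers the
-- degree with no predecessor in ℕ.
theorem CategoryTheory.InjectiveResolution.extMk_zero_eq_zero_iff [HasExt.{w} C] {X Y : C}
    (I : InjectiveResolution Y) (f : X ⟶ I.cocomplex.X 0) (m : ℕ) (hm : 0 + 1 = m)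
    (hf : f ≫ I.cocomplex.d 0 m = 0) : I.extMk f m hm hf = 0 ↔ f = 0 := by
  refine ⟨fun h => ?_, fun h => by subst h; exact I.extMk_zero _ _⟩
  rw [← I.extEquivCohomologyClass.apply_eq_iff_eq, I.extEquivCohomologyClass_extMk,
    I.extEquivCohomologyClass_zero, CohomologyClass.mk_eq_zero_iff,
    Cocycle.fromSingleMk_mem_coboundaries_iff _ _ _ _ _ (-1) (by lia)] at h
  obtain ⟨g, hg⟩ := h
  have hz : IsZero (I.cochainComplex.X (-1)) := I.cochainComplex.isZero_of_isStrictlyGE 0 _ (by lia)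
  rw [hz.eq_of_tgt g 0, zero_comp] at hg
  rw [← cancel_mono (I.cochainComplexXIso 0 0 rfl).inv, zero_comp]
  exact hg.symm

end Homological

end

noncomputable section

namespace Semidualizing

/-! ### The tensor-Hom adjunction for ω. -/

section Adjunction

variable (R S ω : Type u) [Ring R] [Ring S] [AddCommGroup ω] [Module R ω] [Module Sᵐᵒᵖ ω]

theorem btmul_smul {N : Type u} [AddCommGroup N] [Module S N] (x : ω) (s : S) (y : N) :
    btmul R S ω x (s • y) = btmul R S ω (MulOpposite.op s • x) y :=
  ((Submodule.Quotient.eq (balancing R S ω N)).2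
    (Submodule.subset_span ⟨x, s, y, rfl⟩)).symm

theorem btmul_add {N : Type u} [AddCommGroup N] [Module S N] (x : ω) (y y' : N) :
    btmul R S ω x (y + y') = btmul R S ω x y + btmul R S ω x y' := by
  simp only [btmul, TensorProduct.tmul_add, map_add]

theorem add_btmul {N : Type u} [AddCommGroup N] [Module S N] (x x' : ω) (y : N) :
    btmul R S ω (x + x') y = btmul R S ω x y + btmul R S ω x' y := by
  simp only [btmul, TensorProduct.add_tmul, map_add]

variable [SMulCommClass R Sᵐᵒᵖ ω]

theorem rightMul_one : rightMul R S ω 1 = 𝟙 _ := by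
  ext x; exact one_smul Sᵐᵒᵖ x

theorem rightMul_mul (s t : S) :
    rightMul R S ω (s * t) = rightMul R S ω s ≫ rightMul R S ω t := by
  ext x; exact mul_smul (MulOpposite.op t) (MulOpposite.op s) x

theorem rightMul_add (s t : S) :
    rightMul R S ω (s + t) = rightMul R S ω s + rightMul R S ω t := by
  ext x; exact add_smul (MulOpposite.op s) (MulOpposite.op t) x

theorem rightMul_zero : rightMul R S ω 0 = 0 := by
  ext x; exact zero_smul Sᵐᵒᵖ x

/-- The abelian group `Hom_R(ω, M)`, with `S` recorded for its left action. -/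
@[nolint unusedArguments]
def HomGroup (_S : Type u) (M : ModuleCat.{u} R) : Type u := ModuleCat.of R ω ⟶ M

variable {R S ω} in
/-- The morphism underlying an element of `Hom_R(ω, M)`. -/
abbrev HomGroup.toHom {M : ModuleCat.{u} R} (f : HomGroup R ω S M) : ModuleCat.of R ω ⟶ M := f

omit [Ring S] [Module Sᵐᵒᵖ ω] [SMulCommClass R Sᵐᵒᵖ ω] in
variable {R S ω} in
theorem HomGroup.ext {M : ModuleCat.{u} R} {f g : HomGroup R ω S M}
    (h : ∀ x : ω, f.toHom.hom x = g.toHom.hom x) : f = g :=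
  ModuleCat.hom_ext (LinearMap.ext h)

instance (M : ModuleCat.{u} R) : AddCommGroup (HomGroup R ω S M) :=
  inferInstanceAs (AddCommGroup (ModuleCat.of R ω ⟶ M))

/-- `S` acts on `Hom_R(ω, M)` by `(s f)(x) = f(x s)`. -/
instance (M : ModuleCat.{u} R) : Module S (HomGroup R ω S M) where
  smul s f := rightMul R S ω s ≫ HomGroup.toHom f
  one_smul f := by
    change rightMul R S ω 1 ≫ HomGroup.toHom f = f
    rw [rightMul_one]
    exact Category.id_comp _
  mul_smul s t f := by
    change rightMul R S ω (s * t) ≫ HomGroup.toHom f = _ ≫ _ ≫ _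
    rw [rightMul_mul, Category.assoc]
  smul_zero s := Limits.comp_zero
  smul_add s f g := Preadditive.comp_add _ _ _ _ _ _
  add_smul s t f := by
    change rightMul R S ω (s + t) ≫ HomGroup.toHom f = _ ≫ _ + _ ≫ _
    rw [rightMul_add]
    exact Preadditive.add_comp _ _ _ _ _ _
  zero_smul f := by
    change rightMul R S ω 0 ≫ HomGroup.toHom f = _
    rw [rightMul_zero]
    exact Limits.zero_comp

/-- The functor `Hom_R(ω, -) : Mod R ⥤ Mod S`. -/
def homFunctor : ModuleCat.{u} R ⥤ ModuleCat.{u} S where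
  obj M := ModuleCat.of S (HomGroup R ω S M)
  map {M M'} f := ModuleCat.ofHom
    { toFun := fun g => HomGroup.toHom g ≫ f
      map_add' := fun g g' => Preadditive.add_comp _ _ _ _ _ _
      map_smul' := fun s g => Category.assoc _ _ _ }
  map_id M := by ext g; exact Category.comp_id (HomGroup.toHom g)
  map_comp {M _ _} f f' := by
    ext g; exact (Category.assoc (HomGroup.toHom g) f f').symm

instance : (homFunctor R S ω).Additive where
  map_add {M M' f f'} := by
    ext g; exact Preadditive.comp_add _ _ _ (HomGroup.toHom g) f f'

/-- The map `ω ⊗_S N → M` induced by an `S`-linear map `N → Hom_R(ω, M)`. -/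
def balancedLift {N : ModuleCat.{u} S} {M : ModuleCat.{u} R} (g : N ⟶ (homFunctor R S ω).obj M) :
    BalancedTensor R S ω N →ₗ[R] M :=
  (balancing R S ω N).liftQ
    (TensorProduct.AlgebraTensorModule.lift
      { toFun := fun x =>
          { toFun := fun y => (HomGroup.toHom (S := S) (g.hom y)).hom x
            map_add' := fun y y' => by rw [map_add]; rfl
            map_smul' := fun z y => by rw [map_zsmul]; rfl }
        map_add' := fun x x' => by
          ext y; exact map_add (HomGroup.toHom (S := S) (g.hom y)).hom x x'
        map_smul' := fun r x => by
          ext y; exact map_smul (HomGroup.toHom (S := S) (g.hom y)).hom r x }) <| by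
    refine Submodule.span_le.2 ?_
    rintro _ ⟨x, s, y, rfl⟩
    change _ = _
    rw [map_sub, sub_eq_zero]
    change (HomGroup.toHom (S := S) (g.hom y)).hom (MulOpposite.op s • x : ω) =
      (HomGroup.toHom (S := S) (g.hom (s • y))).hom x
    -- Since `(s f)(x) = f(x s)`, `S`-linearity of `g` is exactly the balancing relation.
    rw [g.hom.map_smul]
    rfl

/-- The adjunction between `ω ⊗_S -` and `Hom_R(ω, -)`. -/
def tensorHomAdjunction : tensorFunctor R S ω ⊣ homFunctor R S ω :=
  Adjunction.mkOfHomEquiv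
    { homEquiv := fun N M =>
        { toFun := fun f => ModuleCat.ofHom
            { toFun := fun y => (ModuleCat.ofHom
                { toFun := fun x => f.hom (btmul R S ω x y)
                  map_add' := fun x x' => by
                    rw [add_btmul]; exact map_add f.hom _ _
                  map_smul' := fun r x => (map_smul f.hom r (btmul R S ω x y)) } :
                ModuleCat.of R ω ⟶ M)
              map_add' := fun y y' => by
                refine HomGroup.ext fun x => ?_
                exact (congrArg f.hom (btmul_add R S ω x y y')).trans (map_add f.hom _ _)
              map_smul' := fun s y => by
                exact HomGroup.ext fun x => congrArg f.hom (btmul_smul R S ω x s y) }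
          invFun := fun g => ModuleCat.ofHom (balancedLift R S ω g)
          left_inv := fun f => by
            ext : 1
            exact balancedTensor_hom_ext fun x y => rfl
          right_inv := fun g => rfl }
      homEquiv_naturality_left_symm := fun f g => by
        ext : 1
        exact balancedTensor_hom_ext fun x y => rfl
      homEquiv_naturality_right := fun f g => rfl }

end Adjunction

/-! ### Ext and Tor as homology, and the inductive steps. -/

section Ext

variable (R S ω : Type u) [Ring R] [Ring S] [AddCommGroup ω] [Module R ω] [Module Sᵐᵒᵖ ω]
  [SMulCommClass R Sᵐᵒᵖ ω] {M : ModuleCat.{u} R} (I : InjectiveResolution M)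

/-- The `S`-linear map from the cocycles of `Hom_R(ω, I)` to `Ext_R(ω, M)`, where `I` is an
injective resolution of `M`. -/
def cocyclesToExt (i : ℕ) :
    LinearMap.ker ((homFunctor R S ω).map (I.cocomplex.d i (i + 1))).hom →ₗ[S]
      ExtGroup R ω S i M where
  toFun f := I.extMk (X := ModuleCat.of R ω) f.1 (i + 1) rfl f.2
  map_add' f g := (I.add_extMk (X := ModuleCat.of R ω) f.1 g.1 (i + 1) rfl f.2 g.2).symm
  map_smul' s f :=
    (I.mk₀_comp_extMk (X := ModuleCat.of R ω) f.1 (i + 1) rfl f.2 (rightMul R S ω s)).symm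

theorem cocyclesToExt_surjective (i : ℕ) : Function.Surjective (cocyclesToExt R S ω I i) := by
  intro e
  obtain ⟨f, hf, h⟩ := I.extMk_surjective (X := ModuleCat.of R ω) e (i + 1) rfl
  exact ⟨⟨f, hf⟩, h⟩

/-- For `i = 0`, truncated subtraction gives `i - 1 = 0` and a zero differential, so the right side
says `f = 0`, as it should. -/
theorem cocyclesToExt_eq_zero_iff (i : ℕ)
    (f : LinearMap.ker ((homFunctor R S ω).map (I.cocomplex.d i (i + 1))).hom) :
    cocyclesToExt R S ω I i f = 0 ↔
      ∃ g : HomGroup R ω S (I.cocomplex.X (i - 1)),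
        ((homFunctor R S ω).map (I.cocomplex.d (i - 1) i)).hom g = f.1 := by
  cases i with
  | zero =>
    refine (I.extMk_zero_eq_zero_iff (X := ModuleCat.of R ω) f.1 1 rfl f.2).trans ?_
    have h : I.cocomplex.d (0 - 1) 0 = 0 := I.cocomplex.shape _ _ (by simp)
    rw [h, Functor.map_zero]
    exact ⟨fun h => ⟨0, h.symm⟩, fun ⟨_, h⟩ => h.symm⟩
  | succ i => exact I.extMk_eq_zero_iff (X := ModuleCat.of R ω) f.1 (i + 2) rfl f.2 i rfl

/-- The cohomology of `Hom_R(ω, I)` is `Ext_R(ω, M)` when `I` is an injective resolution of `M`. -/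
def homologyIsoExtModule (i : ℕ) :
    (((homFunctor R S ω).mapHomologicalComplex _).obj I.cocomplex).homology i ≅
      extModule R S ω i M :=
  HomologicalComplex.homologyIsoSc' _ (i - 1) i (i + 1) (by cases i <;> simp) (by simp) ≪≫
    ShortComplex.moduleCatHomologyIso _ ≪≫
    ((Submodule.quotEquivOfEq _ _ (by
      ext f
      refine Iff.trans ?_ (cocyclesToExt_eq_zero_iff R S ω I i f).symm
      exact ⟨fun ⟨g, hg⟩ => ⟨g, congrArg Subtype.val hg⟩, fun ⟨g, hg⟩ => ⟨g, Subtype.ext hg⟩⟩)).trans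
      ((cocyclesToExt R S ω I i).quotKerEquivOfSurjective
        (cocyclesToExt_surjective R S ω I i))).toModuleIso

theorem exactAt_homFunctor_iff (i : ℕ) :
    (((homFunctor R S ω).mapHomologicalComplex _).obj I.cocomplex).ExactAt i ↔
      Subsingleton (Abelian.Ext.{u} (ModuleCat.of R ω) M i) := by
  rw [HomologicalComplex.exactAt_iff_isZero_homology,
    (homologyIsoExtModule R S ω I i).isZero_iff]
  exact ⟨fun h => ModuleCat.subsingleton_of_isZero h,
    fun (h : Subsingleton (extModule R S ω i M)) => ModuleCat.isZero_of_subsingleton _⟩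

omit [SMulCommClass R Sᵐᵒᵖ ω] in
theorem exactAt_tensorFunctor_iff {N : ModuleCat.{u} S} (P : ProjectiveResolution N) (i : ℕ) :
    (((tensorFunctor R S ω).mapHomologicalComplex _).obj P.complex).ExactAt i ↔
      Subsingleton (torModule R S ω i N) := by
  rw [HomologicalComplex.exactAt_iff_isZero_homology]
  have e : torModule R S ω i N ≅ _ := P.isoLeftDerivedObj (tensorFunctor R S ω) i
  refine Iff.trans (Iff.symm e.isZero_iff) ?_
  exact ⟨fun h => ModuleCat.subsingleton_of_isZero h,
    fun _ => ModuleCat.isZero_of_subsingleton _⟩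

/-- The test object is Ext^i(ω, M) itself: the isomorphism onto the cohomology of Hom_R(ω, I) must
be zero, hence so is the identity. -/
theorem subsingleton_ext_of_tor (M : ModuleCat.{u} R) (i : ℕ)
    (hM : ∀ k < i, Subsingleton (Abelian.Ext.{u} (ModuleCat.of R ω) M k))
    (h : ∀ j ≤ i, Subsingleton (torModule R S ω j (extModule R S ω i M))) :
    Subsingleton (Abelian.Ext.{u} (ModuleCat.of R ω) M i) := by
  let I := injectiveResolution M
  let P := projectiveResolution (extModule R S ω i M)
  have e := homologyIsoExtModule R S ω I i
  have h0 := CochainComplex.hom_homology_eq_zero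
    (((homFunctor R S ω).mapHomologicalComplex _).obj I.cocomplex) (extModule R S ω i M) i
    (fun k hk => (exactAt_homFunctor_iff R S ω I k).2 (hM k hk))
    (fun k j hj => (tensorHomAdjunction R S ω).subsingleton_ext_of_injective P
      (I.cocomplex.X k) j ((exactAt_tensorFunctor_iff R S ω P j).2 (h j hj))) e.inv
  have hz : Limits.IsZero (extModule R S ω i M) := by
    rw [Limits.IsZero.iff_id_eq_zero, ← e.inv_hom_id, h0, Limits.zero_comp]
  exact ModuleCat.subsingleton_of_isZero hz

theorem subsingleton_tor_of_ext (N : ModuleCat.{u} S) (i : ℕ)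
    (hN : ∀ k < i, Subsingleton (torModule R S ω k N))
    (h : ∀ j ≤ i, Subsingleton (Abelian.Ext.{u} (ModuleCat.of R ω) (torModule R S ω i N) j)) :
    Subsingleton (torModule R S ω i N) := by
  let P := projectiveResolution N
  let I := injectiveResolution (torModule R S ω i N)
  have e : torModule R S ω i N ≅
      (((tensorFunctor R S ω).mapHomologicalComplex _).obj P.complex).homology i :=
    P.isoLeftDerivedObj (tensorFunctor R S ω) i
  have h0 := ChainComplex.hom_homology_eq_zero
    (((tensorFunctor R S ω).mapHomologicalComplex _).obj P.complex) (torModule R S ω i N) i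
    (fun k hk => (exactAt_tensorFunctor_iff R S ω P k).2 (hN k hk))
    (fun k j hj => (tensorHomAdjunction R S ω).subsingleton_ext_of_projective I
      (P.complex.X k) j ((exactAt_homFunctor_iff R S ω I j).2 (h j hj))) e.inv
  have hz : Limits.IsZero (torModule R S ω i N) := by
    rw [Limits.IsZero.iff_id_eq_zero, ← e.hom_inv_id, h0, Limits.comp_zero]
  exact ModuleCat.subsingleton_of_isZero hz

end Ext

/-- Turns cograde bounds into vanishing statements suited to induction on the degree. -/
theorem natCast_le_sInf_iff (X : ℕ → Type u) (n : ℕ) :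
    ((n + 1 : ℕ) : ℕ∞) ≤ sInf ((fun i : ℕ => (i : ℕ∞)) '' {i | Nontrivial (X i)}) ↔
      ∀ i ≤ n, Subsingleton (X i) := by
  rw [le_sInf_iff, Set.forall_mem_image]
  refine ⟨fun h i hi => ?_, fun h i hi => ?_⟩
  · by_contra hc
    have := h (x := i) (not_subsingleton_iff_nontrivial.1 hc)
    rw [Nat.cast_le] at this
    omega
  · rw [Nat.cast_le]
    by_contra hc
    exact not_subsingleton_iff_nontrivial.2 hi (h i (by omega))

end Semidualizing

end

theorem corollary6p6 {R S ω : Type u} [Ring R] [Ring S] [AddCommGroup ω] [Module R ω]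
    [Module Sᵐᵒᵖ ω] [SMulCommClass R Sᵐᵒᵖ ω]
    (hω : Semidualizing.IsSemidualizing R S ω)
    (M : ModuleCat.{u} R) (N : ModuleCat.{u} S) (n : ℕ) :
    ((∀ i : ℕ, i ≤ n →
        ((i + 1 : ℕ) : ℕ∞) ≤
          Semidualizing.torCograde R S ω (Semidualizing.extModule R S ω i M)) →
      ((n + 1 : ℕ) : ℕ∞) ≤ Semidualizing.extCograde R ω M) ∧
    ((∀ i : ℕ, i ≤ n →
        ((i + 1 : ℕ) : ℕ∞) ≤
          Semidualizing.extCograde R ω (Semidualizing.torModule R S ω i N)) →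
      ((n + 1 : ℕ) : ℕ∞) ≤ Semidualizing.torCograde R S ω N) := by
  simp only [Semidualizing.torCograde, Semidualizing.extCograde,
    Semidualizing.natCast_le_sInf_iff]
  refine ⟨fun h i => ?_, fun h i => ?_⟩
  · induction i using Nat.strong_induction_on with
    | _ i ih =>
      exact fun hi => Semidualizing.subsingleton_ext_of_tor R S ω M i
        (fun k hk => ih k hk (by omega)) (h i hi)
  · induction i using Nat.strong_induction_on with
    | _ i ih =>
      exact fun hi => Semidualizing.subsingleton_tor_of_ext R S ω N i
        (fun k hk => ih k hk (by omega)) (h i hi)
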